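/- Let $n\ge 2$ be an integer and let $p=\frac{2n}{n-1}$. Let $\mathbb D^n=\{z\in\mathbb C^n: |z_j|<1,\ j=1,\dots,n\}$ be the unit polydisc and let $dV$ be Lebesgue measure on $\mathbb C^n$. Let $\Phi_n=(p_1,\dots,p_n):\mathbb C^n\to\mathbb C^n$, where $p_j(w)=\sum_{k_1<\dots<k_j}w_{k_1}\cdots w_{k_j}$ is the elementary symmetric polynomial of degree $j$, and let $J_{\mathbb C}\Phi_n(w)=\prod_{1\le j<k\le n}(w_j-w_k)$ be its complex Jacobian determinant. Let $L^p(\mathbb D^n,|J_{\mathbb C}\Phi_n|^{2-p})$ be the weighted Lebesgue space with norm $$\|f\|=\left(\int_{\mathbb D^n}|f|^p\,|J_{\mathbb C}\Phi_n|^{2-p}\,dV\right)^{1/p},$$ and let $L^p_{\text{anti}}(\mathbb D^n,|J_{\mathbb C}\Phi_n|^{2-p})$ be its subspace of anti-symmetric functions, i.e. of those $f$ that change sign whenever two of the variables $z_1,\dots,z_n$ are interchanged. Let $T^n_2$ be the integral operator $$T^n_2(f)(z)=\int_{\mathbb D^n}\frac{\prod_{1\le j<k\le n}(z_j-z_k)(\bar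 w_j-\bar w_k)}{\pi^n\prod_{1\le j\le k\le n}(1-z_k\bar w_j)(1-z_j\bar w_k)}\,f(w)\,dV(w),\qquad z\in\mathbb D^n.$$ Then for every $f\in L^p_{\text{anti}}(\mathbb D^n,|J_{\mathbb C}\Phi_n|^{2-p})$ and every $z\in\mathbb D^n$ the integral defining $T^n_2(f)(z)$ converges absolutely, and $T^n_2$ is unbounded on $L^p_{\text{anti}}(\mathbb D^n,|J_{\mathbb C}\Phi_n|^{2-p})$: for every constant $C\ge 0$ there is $f\in L^p_{\text{anti}}(\mathbb D^n,|J_{\mathbb C}\Phi_n|^{2-p})$ such that $T^n_2(f)\in L^p_{\text{anti}}(\mathbb D^n,|J_{\mathbb C}\Phi_n|^{2-p})$ and $\|T^n_2(f)\|>C\,\|f\|$. -/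

import Mathlib

open MeasureTheory Finset
open scoped NNReal ENNReal

noncomputable section

/-- The open unit polydisc in `ℂⁿ`. -/
def unitPolydisc (n : ℕ) : Set (Fin n → ℂ) :=
  {z | ∀ j, ‖z j‖ < 1}

/-- The symmetrization map `Φₙ = (p₁, …, pₙ)`, where `pⱼ` is the elementary symmetric polynomial
of degree `j` (the index `i : Fin n` stands for the degree `i + 1`). -/
def symmetrizationMap (n : ℕ) (w : Fin n → ℂ) : Fin n → ℂ :=
  fun i => ∑ s ∈ powersetCard (i.val + 1) (univ : Finset (Fin n)), ∏ k ∈ s, w k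

/-- The complex Jacobian determinant `J_ℂ Φₙ`. -/
def symJacobian (n : ℕ) (w : Fin n → ℂ) : ℂ :=
  (fderiv ℂ (symmetrizationMap n) w).det

/-- The measure `|J_ℂ Φₙ|^{2-p} dV` on the polydisc. -/
def weightedMeasure (n : ℕ) (p : ℝ) : Measure (Fin n → ℂ) :=
  (volume.restrict (unitPolydisc n)).withDensity fun w => ‖symJacobian n w‖ₑ ^ (2 - p)

/-- The norm of `L^p(𝔻ⁿ, |J_ℂ Φₙ|^{2-p})`, with value `∞` for functions of infinite norm. -/
def weightedLpNorm (n : ℕ) (p : ℝ) (f : (Fin n → ℂ) → ℂ) : ℝ≥0∞ :=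
  eLpNorm f (ENNReal.ofReal p) (weightedMeasure n p)

/-- Anti-symmetric functions on the polydisc: interchanging two variables changes the sign. -/
def IsAntisymmetricOnPolydisc (n : ℕ) (f : (Fin n → ℂ) → ℂ) : Prop :=
  ∀ z ∈ unitPolydisc n, ∀ j k : Fin n, j ≠ k → f z = -f (z ∘ Equiv.swap j k)

/-- The (representatives of the) elements of `L^p_anti(𝔻ⁿ, |J_ℂ Φₙ|^{2-p})`. -/
def LpAnti (n : ℕ) (p : ℝ) : Set ((Fin n → ℂ) → ℂ) :=
  {f | MemLp f (ENNReal.ofReal p) (weightedMeasure n p) ∧ IsAntisymmetricOnPolydisc n f}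

/-- The kernel of `T₂ⁿ`. -/
def kernelT2 (n : ℕ) (z w : Fin n → ℂ) : ℂ :=
  (∏ j : Fin n, ∏ k ∈ Ioi j, (z j - z k) * (starRingEnd ℂ (w j) - starRingEnd ℂ (w k))) /
    ((Real.pi : ℂ) ^ n * ∏ j : Fin n, ∏ k ∈ Ici j,
      (1 - z k * starRingEnd ℂ (w j)) * (1 - z j * starRingEnd ℂ (w k)))

/-- The integral operator `T₂ⁿ`. -/
def operatorT2 (n : ℕ) (f : (Fin n → ℂ) → ℂ) (z : Fin n → ℂ) : ℂ :=
  ∫ w in unitPolydisc n, kernelT2 n z w * f w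

theorem fderiv_symmetrizationMap_single (n : ℕ) (w : Fin n → ℂ) (i j : Fin n) :
    fderiv ℂ (symmetrizationMap n) w (Pi.single j 1) i =
      ∑ t ∈ powersetCard i.val (univ.erase j), ∏ k ∈ t, w k := by
  have h1 : ∀ i : Fin n, HasFDerivAt (fun w : Fin n → ℂ => symmetrizationMap n w i)
      (∑ s ∈ powersetCard (i.val + 1) (univ : Finset (Fin n)), ∑ l ∈ s,
        (∏ k ∈ s.erase l, w k) • (ContinuousLinearMap.proj l : (Fin n → ℂ) →L[ℂ] ℂ)) w := by
    intro i
    unfold symmetrizationMap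
    refine HasFDerivAt.fun_sum fun s _ => ?_
    exact HasFDerivAt.finsetProd fun l _ => hasFDerivAt_apply l w
  rw [(hasFDerivAt_pi.2 h1).fderiv]
  simp only [ContinuousLinearMap.pi_apply, _root_.sum_apply,
    smul_apply, ContinuousLinearMap.proj_apply, smul_eq_mul, Pi.single_apply,
    mul_ite, mul_one, mul_zero, Finset.sum_ite_eq']
  rw [← Finset.sum_filter]
  refine Finset.sum_bij' (fun s _ => s.erase j) (fun t _ => insert j t) ?_ ?_ ?_ ?_ ?_
  · intro s hs
    simp only [mem_filter, mem_powersetCard] at hs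
    simp only [mem_powersetCard]
    exact ⟨erase_subset_erase j (subset_univ s), by rw [card_erase_of_mem hs.2, hs.1.2]; rfl⟩
  · intro t ht
    simp only [mem_powersetCard] at ht
    have hj : j ∉ t := fun h => by simpa using ht.1 h
    simp [mem_filter, mem_powersetCard, card_insert_of_notMem hj, ht.2]
  · intro s hs
    exact insert_erase (mem_filter.1 hs).2
  · intro t ht
    simp only [mem_powersetCard] at ht
    have hj : j ∉ t := fun h => by simpa using ht.1 h
    exact erase_insert hj
  · intro s hs
    rfl

/-- The Jacobian determinant is the Vandermonde product `∏_{j<k} (w_j - w_k)`. -/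
theorem symJacobian_eq (n : ℕ) (w : Fin n → ℂ) :
    symJacobian n w = ∏ j : Fin n, ∏ k ∈ Ioi j, (w j - w k) := by
  set E : Matrix (Fin n) (Fin n) ℂ := Matrix.of fun i j =>
    ∑ t ∈ powersetCard i.val (univ.erase j), ∏ k ∈ t, w k with hE
  have hdet : symJacobian n w = E.det := by
    have : LinearMap.toMatrix' (fderiv ℂ (symmetrizationMap n) w : (Fin n → ℂ) →ₗ[ℂ] Fin n → ℂ)
        = E := by
      ext i j
      rw [LinearMap.toMatrix'_apply]
      have := fderiv_symmetrizationMap_single n w i j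
      simpa [hE, Pi.single_apply] using this
    rw [← this, LinearMap.det_toMatrix']
    rfl
  rw [hdet]
  by_cases hw : Function.Injective w
  · have hmul : Matrix.projVandermonde (fun _ => (-1 : ℂ)) w * E =
        Matrix.diagonal fun j => ∏ m ∈ univ.erase j, (w j - w m) := by
      ext k j
      have key : (Matrix.projVandermonde (fun _ => (-1 : ℂ)) w * E) k j =
          ∏ m ∈ univ.erase j, (w k - w m) := by
        have hcard : #((univ : Finset (Fin n)).erase j) + 1 = n := by
          rw [card_erase_add_one (mem_univ j), card_univ, Fintype.card_fin]
        simp only [sub_eq_neg_add]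
        rw [Finset.prod_add, Finset.sum_powerset, hcard, Finset.sum_range, Matrix.mul_apply]
        refine Finset.sum_congr rfl fun i _ => ?_
        rw [Matrix.projVandermonde_apply, hE, Matrix.of_apply, Finset.mul_sum]
        refine Finset.sum_congr rfl fun t ht => ?_
        obtain ⟨ht1, ht2⟩ := mem_powersetCard.1 ht
        rw [Finset.prod_neg, Finset.prod_const, card_sdiff_of_subset ht1, ht2, Fin.val_rev]
        rw [show #((univ : Finset (Fin n)).erase j) - i.val = n - (i.val + 1) by omega]
        ring
      rw [key]
      by_cases hkj : k = j
      · subst hkj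
        simp
      · rw [Matrix.diagonal_apply_ne _ hkj]
        exact Finset.prod_eq_zero (mem_erase.2 ⟨hkj, mem_univ k⟩) (sub_self _)
    have hd := congrArg Matrix.det hmul
    rw [Matrix.det_mul, Matrix.det_diagonal, Matrix.det_projVandermonde] at hd
    have h0 : (∏ i : Fin n, ∏ j ∈ Ioi i, ((-1 : ℂ) * w i - (-1) * w j)) ≠ 0 := by
      refine Finset.prod_ne_zero_iff.2 fun i _ => Finset.prod_ne_zero_iff.2 fun j hj => ?_
      have hij : w j ≠ w i := fun h => (mem_Ioi.1 hj).ne' (hw h)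
      have := sub_ne_zero.2 hij
      intro h
      apply this
      linear_combination h
    apply mul_left_cancel₀ h0
    rw [hd, ← Finset.prod_mul_distrib]
    have hoff := Finset.prod_prod_Ioi_mul_eq_prod_prod_off_diag (fun i j : Fin n => w j - w i)
    simp only [← Finset.compl_singleton]
    rw [← hoff]
    refine Finset.prod_congr rfl fun i _ => ?_
    rw [← Finset.prod_mul_distrib]
    refine Finset.prod_congr rfl fun j _ => ?_
    ring
  · have hw' : ∃ a b, w a = w b ∧ a < b := by
      simp only [Function.Injective, not_forall] at hw
      obtain ⟨a, b, hab, hne⟩ := hw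
      rcases lt_or_gt_of_ne hne with h | h
      · exact ⟨a, b, hab, h⟩
      · exact ⟨b, a, hab.symm, h⟩
    obtain ⟨a, b, hab, hlt⟩ := hw'
    rw [Finset.prod_eq_zero (mem_univ a)
      (Finset.prod_eq_zero (mem_Ioi.2 hlt) (sub_eq_zero.2 hab))]
    refine Matrix.det_zero_of_column_eq hlt.ne fun i => ?_
    simp only [hE, Matrix.of_apply]
    have hmem : ∀ x y : Fin n, ∀ t ∈ powersetCard i.val (univ.erase x),
        t.map (Equiv.swap x y).toEmbedding ∈ powersetCard i.val (univ.erase y) := by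
      intro x y t ht
      simp only [mem_powersetCard, card_map] at ht ⊢
      refine ⟨fun m hm => ?_, ht.2⟩
      obtain ⟨l, hl, rfl⟩ := mem_map.1 hm
      have hlx : l ≠ x := (mem_erase.1 (ht.1 hl)).1
      refine mem_erase.2 ⟨fun h => hlx ?_, mem_univ _⟩
      have := congrArg (Equiv.swap x y) h
      simpa using this
    refine Finset.sum_bij' (fun t _ => t.map (Equiv.swap a b).toEmbedding)
      (fun t _ => t.map (Equiv.swap b a).toEmbedding) (hmem a b) (hmem b a) ?_ ?_ ?_
    · intro t _
      ext m
      simp [Equiv.swap_comm b a]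
    · intro t _
      ext m
      simp [Equiv.swap_comm b a]
    · intro t _
      rw [Finset.prod_map]
      refine Finset.prod_congr rfl fun k _ => ?_
      change w k = w (Equiv.swap a b k)
      rw [Equiv.swap_apply_def]
      split_ifs with h1 h2
      · rw [h1, hab]
      · rw [h2, hab]
      · rfl

end

/-! Write `J` for the Jacobian. For `f = J g` with `g` symmetric, `‖f‖^p = ∫ |J|² |g|^p`, and `T₂ⁿ f
= J h` where `h(z)` integrates `|J|² g` against the reciprocal of `πⁿ kernelDenom n z w`.

Absolute convergence: for fixed `z` the kernel is `O(|J(w)|)`, and `|J||f| ≤ |J|² + |J|^(2-p)|f|^p`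
(`mul_le_sq_add_weight`).

Unboundedness: put `d = 1 - r` and choose `g` on `{|w_j| < r}` so that its phase cancels that of the
kernel at `z = (r, …, r)` and `|g|^p = ∏ |1 - r w̄_j|^(-2n)`. Then `‖f‖^p` and `πⁿ h(r, …, r)` are
the same number `P` (`weightedLpNorm_peakFunction`). On a polydisc of size comparable to `d` near
that point `|h| ≥ P / (4πⁿ)` (`le_norm_peakImage`), and `∫ |J|²` over it is at least a constant
times `d^(n(n+1))`. Hence `‖T₂ⁿ f‖^p / ‖f‖^p` is at least a constant times `P^(p-1) d^(n(n+1)) = (P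
d^(n(n-1)))^(p-1)`, because `p - 1 = (n+1)/(n-1)`.

At this critical exponent `P d^(n(n-1))` diverges logarithmically (`le_peakMass`): let one
coordinate lie at distance about `s` from `1` and the others at distance about `d`. Each scale `s`
between `d` and `1` contributes the same amount, and there are about `log (1/d)` separate scales. -/

/-! ### Algebra of the kernel. -/

/-- The polynomial denominator `∏_{j ≤ k} (1 - z_k w̄_j) (1 - z_j w̄_k)` of the kernel. -/
def kernelDenom (n : ℕ) (z w : Fin n → ℂ) : ℂ :=
  ∏ j : Fin n, ∏ k ∈ Ici j, (1 - z k * starRingEnd ℂ (w j)) * (1 - z j * starRingEnd ℂ (w k))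

/-- A diagonal pair `j = k` contributes its factor twice, an off-diagonal ordered pair once; hence
the extra diagonal product, and `n² + n` factors in all. -/
theorem kernelDenom_eq (n : ℕ) (z w : Fin n → ℂ) :
    kernelDenom n z w = (∏ j, ∏ k, (1 - z j * starRingEnd ℂ (w k))) *
      ∏ j, (1 - z j * starRingEnd ℂ (w j)) := by
  have h1 : ∀ j : Fin n, ∏ k ∈ Ici j,
      (1 - z k * starRingEnd ℂ (w j)) * (1 - z j * starRingEnd ℂ (w k)) =
      (1 - z j * starRingEnd ℂ (w j)) * (1 - z j * starRingEnd ℂ (w j)) *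
      ∏ k ∈ Ioi j, (1 - z k * starRingEnd ℂ (w j)) * (1 - z j * starRingEnd ℂ (w k)) := by
    intro j
    rw [← Finset.Ioi_insert, Finset.prod_insert (by simp)]
  have h2 : ∀ j : Fin n, ∏ k, (1 - z j * starRingEnd ℂ (w k)) =
      (1 - z j * starRingEnd ℂ (w j)) * ∏ k ∈ {j}ᶜ, (1 - z j * starRingEnd ℂ (w k)) := by
    intro j
    rw [Fintype.prod_eq_mul_prod_compl j]
  have h3 := Finset.prod_prod_Ioi_mul_eq_prod_prod_off_diag
    (fun k j : Fin n => 1 - z j * starRingEnd ℂ (w k))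
  simp only [kernelDenom, h1, h2, Finset.prod_mul_distrib] at h3 ⊢
  rw [← h3]
  ring

theorem kernelDenom_eq_prod_sum (n : ℕ) (z w : Fin n → ℂ) :
    kernelDenom n z w = ∏ x : (Fin n × Fin n) ⊕ Fin n,
      (1 - z (Sum.elim Prod.fst id x) * starRingEnd ℂ (w (Sum.elim Prod.snd id x))) := by
  rw [kernelDenom_eq, Fintype.prod_sum_type, Fintype.prod_prod_type]
  rfl

theorem kernelDenom_comp_perm (n : ℕ) (z w : Fin n → ℂ) (σ : Equiv.Perm (Fin n)) :
    kernelDenom n (z ∘ σ) (w ∘ σ) = kernelDenom n z w := by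
  rw [kernelDenom_eq, kernelDenom_eq]
  congr 1
  · rw [← Equiv.prod_comp σ (fun j => ∏ k, (1 - z j * starRingEnd ℂ (w k)))]
    refine Finset.prod_congr rfl fun j _ => ?_
    exact Equiv.prod_comp σ (fun k => (1 - z (σ j) * starRingEnd ℂ (w k)))
  · exact Equiv.prod_comp σ (fun j => (1 - z j * starRingEnd ℂ (w j)))

theorem kernelDenom_const (n : ℕ) (r : ℂ) (w : Fin n → ℂ) :
    kernelDenom n (fun _ => r) w = ∏ j, (1 - r * starRingEnd ℂ (w j)) ^ (n + 1) := by
  rw [kernelDenom_eq, Finset.prod_const, Finset.card_univ, Fintype.card_fin, Finset.prod_pow,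
    pow_succ]

theorem symJacobian_comp_swap (n : ℕ) (z : Fin n → ℂ) {j k : Fin n} (h : j ≠ k) :
    symJacobian n (z ∘ Equiv.swap j k) = -symJacobian n z := by
  -- The Vandermonde determinant is a product of later minus earlier nodes, so the nodes are
  -- negated.
  have h1 : ∀ z : Fin n → ℂ, symJacobian n z = (Matrix.vandermonde fun i => - z i).det := by
    intro z
    rw [symJacobian_eq, Matrix.det_vandermonde]
    refine Finset.prod_congr rfl fun i _ => Finset.prod_congr rfl fun l _ => by ring
  rw [h1, h1]
  have h2 := Matrix.det_permute (Equiv.swap j k) (Matrix.vandermonde fun i => - z i)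
  rw [Equiv.Perm.sign_swap h] at h2
  simpa [Matrix.vandermonde, Matrix.submatrix, Function.comp_def] using h2

theorem kernelT2_eq (n : ℕ) (z w : Fin n → ℂ) :
    kernelT2 n z w = symJacobian n z * starRingEnd ℂ (symJacobian n w) /
      ((Real.pi : ℂ) ^ n * kernelDenom n z w) := by
  rw [kernelT2, symJacobian_eq, symJacobian_eq, kernelDenom]
  simp only [map_prod, map_sub, Finset.prod_mul_distrib]

theorem continuous_symJacobian (n : ℕ) : Continuous (symJacobian n) := by
  have : symJacobian n = fun w => ∏ j : Fin n, ∏ k ∈ Ioi j, (w j - w k) :=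
    funext (symJacobian_eq n)
  rw [this]
  fun_prop

theorem norm_symJacobian_le (n : ℕ) {w : Fin n → ℂ} (hw : w ∈ unitPolydisc n) :
    ‖symJacobian n w‖ ≤ 2 ^ (n * n) := by
  rw [symJacobian_eq, norm_prod]
  have h : ∀ j ∈ (univ : Finset (Fin n)), ‖∏ k ∈ Ioi j, (w j - w k)‖ ≤ 2 ^ n := by
    intro j _
    rw [norm_prod]
    have h2 : ∀ k ∈ Ioi j, ‖w j - w k‖ ≤ 2 := fun k _ => by
      have := hw j
      have := hw k
      linarith [norm_sub_le (w j) (w k)]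
    refine (Finset.prod_le_prod (fun _ _ => norm_nonneg _) h2).trans ?_
    rw [Finset.prod_const]
    exact pow_le_pow_right₀ one_le_two ((Finset.card_le_univ (Ioi j)).trans_eq (Fintype.card_fin n))
  refine (Finset.prod_le_prod (fun _ _ => norm_nonneg _) h).trans ?_
  simp [pow_mul]

/-! ### The weighted measure and absolute convergence of the integral. -/

theorem isOpen_unitPolydisc (n : ℕ) : IsOpen (unitPolydisc n) := by
  have : unitPolydisc n = ⋂ j, {z | ‖z j‖ < 1} := by ext; simp [unitPolydisc]
  rw [this]
  exact isOpen_iInter_of_finite fun j => isOpen_lt (by fun_prop) continuous_const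

theorem volume_unitPolydisc_lt_top (n : ℕ) : volume (unitPolydisc n) < ∞ := by
  refine lt_of_le_of_lt (measure_mono (t := Metric.closedBall 0 1) ?_)
    (isCompact_closedBall _ _).measure_lt_top
  intro z hz
  rw [mem_closedBall_zero_iff, pi_norm_le_iff_of_nonneg zero_le_one]
  exact fun j => (hz j).le

theorem le_norm_one_sub_mul {a : ℝ} {x y : ℂ} (hx : ‖x‖ ≤ a) (hy : ‖y‖ ≤ 1) :
    1 - a ≤ ‖1 - x * starRingEnd ℂ y‖ := by
  have h1 := norm_sub_norm_le (1 : ℂ) (x * starRingEnd ℂ y)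
  rw [norm_one, norm_mul, RCLike.norm_conj] at h1
  have : ‖x‖ * ‖y‖ ≤ ‖x‖ * 1 := by gcongr
  linarith

theorem pow_le_norm_kernelDenom (n : ℕ) {z w : Fin n → ℂ} {c : ℝ} (hc : 0 ≤ c)
    (h : ∀ j k, c ≤ ‖1 - z j * starRingEnd ℂ (w k)‖) :
    c ^ (n * n + n) ≤ ‖kernelDenom n z w‖ := by
  rw [kernelDenom_eq_prod_sum, norm_prod]
  calc c ^ (n * n + n) = ∏ x : (Fin n × Fin n) ⊕ Fin n, c := by simp
    _ ≤ _ := Finset.prod_le_prod (fun _ _ => hc) fun x _ => h _ _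

/-- With `a = |J|`, this turns the weight into `|J|²` for functions of the form `J g`. At `a = 0`
the weight may be `∞`, but it multiplies `0`. -/
theorem rpow_two_sub_mul_mul_rpow {p : ℝ} (hp : 0 < p) {a g : ℝ≥0∞} (ha : a ≠ ∞) :
    a ^ (2 - p) * (a * g) ^ p = a ^ (2 : ℝ) * g ^ p := by
  rw [ENNReal.mul_rpow_of_nonneg _ _ hp.le, ← mul_assoc]
  rcases eq_or_ne a 0 with rfl | h0
  · simp [ENNReal.zero_rpow_of_pos hp]
  · rw [← ENNReal.rpow_add _ _ h0 ha]
    congr 2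
    ring

theorem measurable_weight (n : ℕ) (p : ℝ) :
    Measurable fun w : Fin n → ℂ => ‖symJacobian n w‖ₑ ^ (2 - p) :=
  ((continuous_symJacobian n).measurable.enorm).pow_const _

/-- The exponent `2 - p` is not positive, so the weight vanishes nowhere. This transfers
measurability from the weighted measure to Lebesgue measure. -/
theorem volume_restrict_absolutelyContinuous_weightedMeasure (n : ℕ) {p : ℝ} (hp : 2 ≤ p) :
    volume.restrict (unitPolydisc n) ≪ weightedMeasure n p := by
  refine withDensity_absolutelyContinuous' (measurable_weight n p).aemeasurable ?_
  refine Filter.Eventually.of_forall fun w => ?_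
  rw [ne_eq, ENNReal.rpow_eq_zero_iff]
  rintro (⟨-, h⟩ | ⟨h, -⟩)
  · linarith
  · exact enorm_ne_top h

/-- The first term dominates when `b ≤ a`. When `a ≤ b`, write `a = a^(2-p) a^(p-1)` and enlarge
`a^(p-1)` to `b^(p-1)`. -/
theorem mul_le_sq_add_weight {p : ℝ} (hp : 1 ≤ p) {a b : ℝ≥0∞} (ha : a ≠ ∞) (hb' : b ≠ ∞) :
    a * b ≤ a ^ (2 : ℝ) + a ^ (2 - p) * b ^ p := by
  rcases le_total b a with h | h
  · refine le_add_right ?_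
    rw [ENNReal.rpow_two, sq]
    gcongr
  · refine le_add_left ?_
    rcases eq_or_ne a 0 with rfl | h0
    · simp
    · calc a * b = a ^ (2 - p) * a ^ (p - 1) * b := by
            rw [← ENNReal.rpow_add _ _ h0 ha]
            norm_num
        _ ≤ a ^ (2 - p) * b ^ (p - 1) * b := by
            gcongr
        _ = a ^ (2 - p) * b ^ p := by
            rw [mul_assoc]
            congr 1
            have hb : b ≠ 0 := (lt_of_lt_of_le (pos_iff_ne_zero.2 h0) h).ne'
            nth_rewrite 2 [← ENNReal.rpow_one b]
            rw [← ENNReal.rpow_add _ _ hb hb']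
            norm_num

theorem lintegral_weightedMeasure (n : ℕ) (p : ℝ) {g : (Fin n → ℂ) → ℝ≥0∞}
    (hg : AEMeasurable g (volume.restrict (unitPolydisc n))) :
    ∫⁻ w, g w ∂weightedMeasure n p =
      ∫⁻ w in unitPolydisc n, ‖symJacobian n w‖ₑ ^ (2 - p) * g w := by
  rw [weightedMeasure, lintegral_withDensity_eq_lintegral_mul₀
    (measurable_weight n p).aemeasurable hg]
  rfl

theorem norm_kernelT2_le (n : ℕ) {z w : Fin n → ℂ} {c : ℝ} (hc : 0 < c)
    (h : ∀ j k, c ≤ ‖1 - z j * starRingEnd ℂ (w k)‖) :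
    ‖kernelT2 n z w‖ ≤
      ‖symJacobian n z‖ * (Real.pi ^ n * c ^ (n * n + n))⁻¹ * ‖symJacobian n w‖ := by
  have h1 := pow_le_norm_kernelDenom n hc.le h
  rw [kernelT2_eq, norm_div, norm_mul, norm_mul, RCLike.norm_conj, norm_pow, Complex.norm_real,
    Real.norm_of_nonneg Real.pi_pos.le, div_eq_mul_inv, mul_right_comm]
  gcongr

theorem measurable_kernelT2 (n : ℕ) :
    Measurable fun x : (Fin n → ℂ) × (Fin n → ℂ) => kernelT2 n x.1 x.2 := by
  have h : Continuous fun z : ℂ => starRingEnd ℂ z := Complex.continuous_conj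
  refine Measurable.div (Continuous.measurable ?_) (Continuous.measurable ?_) <;> fun_prop

theorem integrableOn_kernelT2_mul (n : ℕ) {p : ℝ} (hp : 2 ≤ p) {f : (Fin n → ℂ) → ℂ}
    (hf : f ∈ LpAnti n p) {z : Fin n → ℂ} (hz : z ∈ unitPolydisc n) :
    IntegrableOn (fun w => kernelT2 n z w * f w) (unitPolydisc n) := by
  have hp0 : 0 < p := by linarith
  have hac := volume_restrict_absolutelyContinuous_weightedMeasure n hp
  have hfm := hf.1.1.mono_ac hac
  obtain ⟨c, hc, hcz⟩ : ∃ c : ℝ, 0 < c ∧ ∀ j, c ≤ 1 - ‖z j‖ := by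
    have : ∀ᶠ c : ℝ in nhdsWithin 0 (Set.Ioi 0), ∀ j, c ≤ 1 - ‖z j‖ := by
      refine Filter.eventually_all.2 fun j => ?_
      exact nhdsWithin_le_nhds (eventually_le_nhds (sub_pos.2 (hz j)))
    obtain ⟨c, h1, h2⟩ := (this.and self_mem_nhdsWithin).exists
    exact ⟨c, h2, h1⟩
  have hlp := lintegral_rpow_enorm_lt_top_of_eLpNorm_lt_top
    (by simpa using hp0) ENNReal.ofReal_ne_top hf.1.2
  rw [ENNReal.toReal_ofReal hp0.le,
    lintegral_weightedMeasure n p (hfm.enorm.pow_const _)] at hlp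
  refine ⟨((measurable_kernelT2 n).of_uncurry_left (x := z)).aestronglyMeasurable.mul hfm, ?_⟩
  have hJ : ∫⁻ w in unitPolydisc n, ‖symJacobian n w‖ₑ ^ (2 : ℝ) < ∞ := by
    refine lt_of_le_of_lt (setLIntegral_mono' (isOpen_unitPolydisc n).measurableSet
      (g := fun _ => (ENNReal.ofReal (2 ^ (n * n))) ^ (2 : ℝ)) fun w hw => ?_) ?_
    · gcongr
      rw [← ofReal_norm]
      exact ENNReal.ofReal_le_ofReal (norm_symJacobian_le n hw)
    · rw [setLIntegral_const]
      exact ENNReal.mul_lt_top (ENNReal.rpow_lt_top_of_nonneg (by norm_num) ENNReal.ofReal_ne_top)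
        (volume_unitPolydisc_lt_top n)
  set B := ‖symJacobian n z‖ * (Real.pi ^ n * c ^ (n * n + n))⁻¹ with hB
  refine lt_of_le_of_lt (setLIntegral_mono' (isOpen_unitPolydisc n).measurableSet
      (g := fun w => ENNReal.ofReal B * (‖symJacobian n w‖ₑ ^ (2 : ℝ) +
        ‖symJacobian n w‖ₑ ^ (2 - p) * ‖f w‖ₑ ^ p)) fun w hw => ?_) ?_
  · refine le_trans ?_ (mul_le_mul_right (mul_le_sq_add_weight (by linarith) enorm_ne_top
      enorm_ne_top) _)
    rw [enorm_mul, ← mul_assoc]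
    gcongr
    rw [← ofReal_norm, ← ofReal_norm, ← ENNReal.ofReal_mul (by positivity)]
    refine ENNReal.ofReal_le_ofReal (norm_kernelT2_le n hc fun j k => ?_)
    linarith [le_norm_one_sub_mul (le_refl ‖z j‖) (hw k).le, hcz j]
  · rw [lintegral_const_mul' _ _ ENNReal.ofReal_ne_top, lintegral_add_left]
    · exact ENNReal.mul_lt_top ENNReal.ofReal_lt_top (ENNReal.add_lt_top.2 ⟨hJ, hlp⟩)
    · exact ((continuous_symJacobian n).measurable.enorm).pow_const _

/-! ### Functions of the form Jacobian times a symmetric factor. -/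

theorem weightedLpNorm_symJacobian_mul (n : ℕ) {p : ℝ} (hp : 0 < p) {g : (Fin n → ℂ) → ℂ}
    (hg : Measurable g) :
    weightedLpNorm n p (fun w => symJacobian n w * g w) =
      (∫⁻ w in unitPolydisc n, ‖symJacobian n w‖ₑ ^ (2 : ℝ) * ‖g w‖ₑ ^ p) ^ (1 / p) := by
  have hJ := (continuous_symJacobian n).measurable
  rw [weightedLpNorm, eLpNorm_eq_lintegral_rpow_enorm_toReal (by simpa using hp)
    ENNReal.ofReal_ne_top, ENNReal.toReal_ofReal hp.le,
    lintegral_weightedMeasure n p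
      (g := fun w => ‖symJacobian n w * g w‖ₑ ^ p) ((hJ.mul hg).enorm.pow_const _).aemeasurable]
  congr 1
  refine lintegral_congr fun w => ?_
  rw [enorm_mul, rpow_two_sub_mul_mul_rpow hp enorm_ne_top]

theorem symJacobian_mul_mem_LpAnti (n : ℕ) {p : ℝ} (hp : 0 < p) {g : (Fin n → ℂ) → ℂ}
    (hg : Measurable g) {B : ℝ} (hB : ∀ w ∈ unitPolydisc n, ‖g w‖ ≤ B)
    (hs : ∀ w ∈ unitPolydisc n, ∀ j k, g (w ∘ Equiv.swap j k) = g w) :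
    (fun w => symJacobian n w * g w) ∈ LpAnti n p := by
  have hJ := (continuous_symJacobian n).measurable
  refine ⟨⟨(hJ.mul hg).aestronglyMeasurable, ?_⟩, fun z hz j k hjk => ?_⟩
  · change weightedLpNorm n p _ < _
    rw [weightedLpNorm_symJacobian_mul n hp hg]
    refine ENNReal.rpow_lt_top_of_nonneg (by positivity) (ne_of_lt ?_)
    refine lt_of_le_of_lt (setLIntegral_mono' (isOpen_unitPolydisc n).measurableSet
      (g := fun _ => (ENNReal.ofReal (2 ^ (n * n))) ^ (2 : ℝ) * ENNReal.ofReal B ^ p)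
      fun w hw => ?_) ?_
    · gcongr
      · rw [← ofReal_norm]
        exact ENNReal.ofReal_le_ofReal (norm_symJacobian_le n hw)
      · rw [← ofReal_norm]
        exact ENNReal.ofReal_le_ofReal (hB w hw)
    · rw [setLIntegral_const]
      exact ENNReal.mul_lt_top (ENNReal.mul_lt_top
        (ENNReal.rpow_lt_top_of_nonneg (by norm_num) ENNReal.ofReal_ne_top)
        (ENNReal.rpow_lt_top_of_nonneg hp.le ENNReal.ofReal_ne_top))
        (volume_unitPolydisc_lt_top n)
  · simp only [symJacobian_comp_swap n z hjk, hs z hz j k]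
    ring

/-! ### The test function, its norm and its image. -/

/-- The polydisc of radius `r` centred at the origin. -/
def smallPolydisc (n : ℕ) (r : ℝ) : Set (Fin n → ℂ) :=
  {z | ∀ j, ‖z j‖ < r}

/-- The factor `∏_j |1 - r w_j|^{-2n}`. -/
noncomputable def peakWeight (n : ℕ) (r : ℝ) (w : Fin n → ℂ) : ℝ :=
  ∏ j, (‖1 - (r : ℂ) * starRingEnd ℂ (w j)‖ ^ (2 * n))⁻¹

/-- The symmetric factor of the test function. -/
noncomputable def peakFactor (n : ℕ) (r : ℝ) (w : Fin n → ℂ) : ℂ :=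
  (peakWeight n r w : ℂ) * kernelDenom n (fun _ => (r : ℂ)) w

/-- The `p`-th power of the norm of the test function. -/
noncomputable def peakMass (n : ℕ) (r : ℝ) : ℝ :=
  ∫ w in smallPolydisc n r, ‖symJacobian n w‖ ^ 2 * peakWeight n r w

/-- The quotient of `T₂ⁿ f` by the Jacobian determinant, for the test function `f`. -/
noncomputable def peakImage (n : ℕ) (r : ℝ) (z : Fin n → ℂ) : ℂ :=
  ∫ w in smallPolydisc n r, ((‖symJacobian n w‖ ^ 2 * peakWeight n r w : ℝ) : ℂ) *
    ((Real.pi : ℂ) ^ n)⁻¹ * (kernelDenom n (fun _ => (r : ℂ)) w / kernelDenom n z w)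

section

variable {n : ℕ} {r : ℝ}

theorem smallPolydisc_subset (hr : r ≤ 1) : smallPolydisc n r ⊆ unitPolydisc n :=
  fun _ hw j => (hw j).trans_le hr

theorem isOpen_smallPolydisc (n : ℕ) (r : ℝ) : IsOpen (smallPolydisc n r) := by
  have : smallPolydisc n r = ⋂ j, {z | ‖z j‖ < r} := by ext; simp [smallPolydisc]
  rw [this]
  exact isOpen_iInter_of_finite fun j => isOpen_lt (by fun_prop) continuous_const

theorem continuous_kernelDenom (n : ℕ) :
    Continuous fun x : (Fin n → ℂ) × (Fin n → ℂ) => kernelDenom n x.1 x.2 := by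
  have h : Continuous fun z : ℂ => starRingEnd ℂ z := Complex.continuous_conj
  unfold kernelDenom
  fun_prop

theorem measurable_peakWeight (n : ℕ) (r : ℝ) : Measurable (peakWeight n r) := by
  have h : Continuous fun z : ℂ => starRingEnd ℂ z := Complex.continuous_conj
  unfold peakWeight
  refine Finset.measurable_prod _ fun j _ => Measurable.inv (Continuous.measurable ?_)
  fun_prop

theorem measurable_peakFactor (n : ℕ) (r : ℝ) : Measurable (peakFactor n r) := by
  refine (Complex.measurable_ofReal.comp (measurable_peakWeight n r)).mul ?_
  exact ((continuous_kernelDenom n).comp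
    (continuous_const.prodMk continuous_id)).measurable

theorem peakWeight_nonneg (w : Fin n → ℂ) : 0 ≤ peakWeight n r w :=
  Finset.prod_nonneg fun _ _ => by positivity

theorem one_sub_le_norm (hr0 : 0 ≤ r) {x : ℂ} (hx : ‖x‖ ≤ 1) :
    1 - r ≤ ‖1 - (r : ℂ) * starRingEnd ℂ x‖ :=
  le_norm_one_sub_mul (by rw [Complex.norm_real, Real.norm_of_nonneg hr0]) hx

theorem peakWeight_le (hr0 : 0 ≤ r) (hr : r < 1) {w : Fin n → ℂ} (hw : w ∈ unitPolydisc n) :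
    peakWeight n r w ≤ (((1 - r) ^ (2 * n))⁻¹) ^ n := by
  have h : ∀ j ∈ (univ : Finset (Fin n)),
      (‖1 - (r : ℂ) * starRingEnd ℂ (w j)‖ ^ (2 * n))⁻¹ ≤ ((1 - r) ^ (2 * n))⁻¹ := by
    intro j _
    have h1 := one_sub_le_norm hr0 (hw j).le
    have h2 : 0 < 1 - r := by linarith
    gcongr
  refine (Finset.prod_le_prod (fun _ _ => by positivity) h).trans ?_
  simp

theorem norm_kernelDenom_le {z w : Fin n → ℂ} (hz : ∀ j, ‖z j‖ ≤ 1) (hw : ∀ j, ‖w j‖ ≤ 1) :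
    ‖kernelDenom n z w‖ ≤ 2 ^ (n * n + n) := by
  rw [kernelDenom_eq_prod_sum, norm_prod]
  calc _ ≤ ∏ x : (Fin n × Fin n) ⊕ Fin n, (2 : ℝ) := by
        refine Finset.prod_le_prod (fun _ _ => norm_nonneg _) fun x _ => ?_
        refine (norm_sub_le _ _).trans ?_
        rw [norm_one, norm_mul, RCLike.norm_conj]
        have := mul_le_one₀ (hz (Sum.elim Prod.fst id x)) (norm_nonneg _)
          (hw (Sum.elim Prod.snd id x))
        linarith
    _ = _ := by simp

/-- The exponent of `|1 - r w̄_j|` is `-2n` from the weight plus `n + 1` from the denominator, that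
is `-(n-1)`; multiplied by `p` it is `-2n` again. -/
theorem norm_peakFactor_rpow (hn : 2 ≤ n) (hr0 : 0 ≤ r) (hr : r < 1) {w : Fin n → ℂ}
    (hw : w ∈ unitPolydisc n) :
    ‖peakFactor n r w‖ ^ (2 * (n : ℝ) / ((n : ℝ) - 1)) = peakWeight n r w := by
  have hn1 : (1 : ℝ) < n := by exact_mod_cast hn
  have h0 : ∀ j, 0 < ‖1 - (r : ℂ) * starRingEnd ℂ (w j)‖ := fun j => by
    linarith [one_sub_le_norm hr0 (hw j).le]
  have h : ‖peakFactor n r w‖ =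
      ∏ j, ‖1 - (r : ℂ) * starRingEnd ℂ (w j)‖ ^ (-((n : ℝ) - 1)) := by
    rw [peakFactor, kernelDenom_const, norm_mul, Complex.norm_real,
      Real.norm_of_nonneg (peakWeight_nonneg w), norm_prod, peakWeight, ← Finset.prod_mul_distrib]
    refine Finset.prod_congr rfl fun j _ => ?_
    rw [norm_pow, ← Real.rpow_natCast, ← Real.rpow_natCast, ← Real.rpow_neg (h0 j).le,
      ← Real.rpow_add (h0 j)]
    congr 1
    push_cast
    ring
  rw [h, ← Real.finsetProd_rpow _ _ fun j _ => by positivity]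
  refine Finset.prod_congr rfl fun j _ => ?_
  rw [← Real.rpow_natCast, ← Real.rpow_neg (h0 j).le, ← Real.rpow_mul (h0 j).le]
  congr 1
  push_cast
  have : (n : ℝ) - 1 ≠ 0 := by linarith
  field_simp

theorem norm_sq_mul_peakWeight_le (hr0 : 0 ≤ r) (hr : r < 1) {w : Fin n → ℂ}
    (hw : w ∈ unitPolydisc n) :
    ‖symJacobian n w‖ ^ 2 * peakWeight n r w ≤
      (2 ^ (n * n)) ^ 2 * (((1 - r) ^ (2 * n))⁻¹) ^ n := by
  gcongr
  · exact peakWeight_nonneg w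
  · exact norm_symJacobian_le n hw
  · exact peakWeight_le hr0 hr hw

theorem measurable_norm_sq_mul_peakWeight (n : ℕ) (r : ℝ) :
    Measurable fun w => ‖symJacobian n w‖ ^ 2 * peakWeight n r w :=
  ((continuous_symJacobian n).norm.pow 2).measurable.mul (measurable_peakWeight n r)

theorem volume_smallPolydisc_lt_top (hr : r ≤ 1) : volume (smallPolydisc n r) < ∞ :=
  (measure_mono (smallPolydisc_subset hr)).trans_lt (volume_unitPolydisc_lt_top n)

theorem integrableOn_norm_sq_mul_peakWeight (hr0 : 0 ≤ r) (hr : r < 1) :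
    IntegrableOn (fun w => ‖symJacobian n w‖ ^ 2 * peakWeight n r w) (smallPolydisc n r) := by
  refine IntegrableOn.of_bound (volume_smallPolydisc_lt_top hr.le)
    (measurable_norm_sq_mul_peakWeight n r).aestronglyMeasurable
    ((2 ^ (n * n)) ^ 2 * (((1 - r) ^ (2 * n))⁻¹) ^ n) ?_
  refine (ae_restrict_iff' (isOpen_smallPolydisc n r).measurableSet).2
    (Filter.Eventually.of_forall fun w hw => ?_)
  rw [Real.norm_of_nonneg (mul_nonneg (by positivity) (peakWeight_nonneg w))]
  exact norm_sq_mul_peakWeight_le hr0 hr (smallPolydisc_subset hr.le hw)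

theorem peakMass_nonneg : 0 ≤ peakMass n r :=
  integral_nonneg fun w => mul_nonneg (by positivity) (peakWeight_nonneg w)

/-- The test function showing that `T₂ⁿ` is unbounded. -/
noncomputable def peakFunction (n : ℕ) (r : ℝ) (w : Fin n → ℂ) : ℂ :=
  symJacobian n w * (smallPolydisc n r).indicator (peakFactor n r) w

theorem comp_perm_mem_smallPolydisc (σ : Equiv.Perm (Fin n)) (w : Fin n → ℂ) :
    w ∘ σ ∈ smallPolydisc n r ↔ w ∈ smallPolydisc n r :=
  σ.forall_congr_left.trans (by simp [smallPolydisc])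

theorem peakWeight_comp_perm (σ : Equiv.Perm (Fin n)) (w : Fin n → ℂ) :
    peakWeight n r (w ∘ σ) = peakWeight n r w :=
  Equiv.prod_comp σ fun j => (‖1 - (r : ℂ) * starRingEnd ℂ (w j)‖ ^ (2 * n))⁻¹

theorem peakFunction_mem_LpAnti {p : ℝ} (hp : 0 < p) (hr0 : 0 ≤ r) (hr : r < 1) :
    peakFunction n r ∈ LpAnti n p := by
  refine symJacobian_mul_mem_LpAnti n hp
    ((measurable_peakFactor n r).indicator (isOpen_smallPolydisc n r).measurableSet)
    (B := (((1 - r) ^ (2 * n))⁻¹) ^ n * 2 ^ (n * n + n)) (fun w hw => ?_) fun w hw j k => ?_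
  · refine (norm_indicator_le_norm_self _ _).trans ?_
    rw [peakFactor, norm_mul, Complex.norm_real, Real.norm_of_nonneg (peakWeight_nonneg w)]
    gcongr
    · exact peakWeight_le hr0 hr hw
    · refine norm_kernelDenom_le (fun _ => ?_) fun j => (hw j).le
      rw [Complex.norm_real, Real.norm_of_nonneg hr0]
      exact hr.le
  · have h1 := comp_perm_mem_smallPolydisc (r := r) (Equiv.swap j k) w
    have h2 : peakFactor n r (w ∘ Equiv.swap j k) = peakFactor n r w := by
      rw [peakFactor, peakFactor, peakWeight_comp_perm]
      congr 1
      exact kernelDenom_comp_perm n (fun _ => (r : ℂ)) w (Equiv.swap j k)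
    by_cases h : w ∈ smallPolydisc n r
    · rw [Set.indicator_of_mem h, Set.indicator_of_mem (h1.2 h), h2]
    · rw [Set.indicator_of_notMem h, Set.indicator_of_notMem (mt h1.1 h)]

theorem weightedLpNorm_peakFunction (hn : 2 ≤ n) (hr0 : 0 ≤ r) (hr : r < 1) {p : ℝ}
    (hp : p = 2 * (n : ℝ) / ((n : ℝ) - 1)) (hp0 : 0 < p) :
    weightedLpNorm n p (peakFunction n r) = ENNReal.ofReal (peakMass n r) ^ (1 / p) := by
  have hm := (isOpen_smallPolydisc n r).measurableSet
  have hrr : volume.restrict (smallPolydisc n r) =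
      (volume.restrict (unitPolydisc n)).restrict (smallPolydisc n r) := by
    rw [Measure.restrict_restrict hm, Set.inter_eq_left.2 (smallPolydisc_subset hr.le)]
  unfold peakFunction
  rw [weightedLpNorm_symJacobian_mul n hp0 ((measurable_peakFactor n r).indicator hm), peakMass,
    ofReal_integral_eq_lintegral_ofReal (integrableOn_norm_sq_mul_peakWeight hr0 hr)
      (Filter.Eventually.of_forall fun w => mul_nonneg (by positivity) (peakWeight_nonneg w)),
    hrr,
    ← lintegral_indicator hm]
  congr 1
  refine setLIntegral_congr_fun (isOpen_unitPolydisc n).measurableSet fun w hw => ?_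
  by_cases h : w ∈ smallPolydisc n r
  · rw [Set.indicator_of_mem h, Set.indicator_of_mem h,
      ENNReal.ofReal_mul (by positivity), ← ofReal_norm, ← ofReal_norm,
      ENNReal.ofReal_rpow_of_nonneg (norm_nonneg _) hp0.le,
      ENNReal.ofReal_rpow_of_nonneg (norm_nonneg _) zero_le_two, Real.rpow_two, hp,
      norm_peakFactor_rpow hn hr0 hr hw]
  · simp [Set.indicator_of_notMem h, hp0]

theorem operatorT2_peakFunction (hr : r ≤ 1) (z : Fin n → ℂ) :
    operatorT2 n (peakFunction n r) z = symJacobian n z * peakImage n r z := by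
  have hm := (isOpen_smallPolydisc n r).measurableSet
  have h1 : ∀ w, kernelT2 n z w * peakFunction n r w = (smallPolydisc n r).indicator
      (fun w => symJacobian n z * (((‖symJacobian n w‖ ^ 2 * peakWeight n r w : ℝ) : ℂ) *
        ((Real.pi : ℂ) ^ n)⁻¹ * (kernelDenom n (fun _ => (r : ℂ)) w / kernelDenom n z w))) w := by
    intro w
    rw [peakFunction]
    by_cases h : w ∈ smallPolydisc n r
    · rw [Set.indicator_of_mem h, Set.indicator_of_mem h, peakFactor, kernelT2_eq]
      push_cast
      rw [← Complex.conj_mul']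
      ring
    · rw [Set.indicator_of_notMem h, Set.indicator_of_notMem h, mul_zero, mul_zero]
  rw [operatorT2, peakImage, ← integral_const_mul]
  simp only [h1]
  rw [setIntegral_indicator hm, Set.inter_eq_right.2 (smallPolydisc_subset hr)]

theorem measurable_peakImage (n : ℕ) (r : ℝ) : Measurable (peakImage n r) := by
  refine StronglyMeasurable.measurable (StronglyMeasurable.integral_prod_right
    (f := fun z w => ((‖symJacobian n w‖ ^ 2 * peakWeight n r w : ℝ) : ℂ) *
    ((Real.pi : ℂ) ^ n)⁻¹ * (kernelDenom n (fun _ => (r : ℂ)) w / kernelDenom n z w)) ?_)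
  have h1 : Measurable fun x : (Fin n → ℂ) × (Fin n → ℂ) =>
      ((‖symJacobian n x.2‖ ^ 2 * peakWeight n r x.2 : ℝ) : ℂ) :=
    Complex.measurable_ofReal.comp
      ((measurable_norm_sq_mul_peakWeight n r).comp measurable_snd)
  have h2 : Measurable fun x : (Fin n → ℂ) × (Fin n → ℂ) =>
      kernelDenom n (fun _ => (r : ℂ)) x.2 :=
    ((continuous_kernelDenom n).comp (continuous_const.prodMk continuous_snd)).measurable
  exact ((h1.mul_const _).mul (h2.div (continuous_kernelDenom n).measurable)).stronglyMeasurable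

/-- Truncating the test function to `|w_j| < r` keeps `|1 - z_j w̄_k| ≥ 1 - r` uniformly in `z`, so
`peakImage` is bounded on the polydisc and the image lies in the space. -/
theorem norm_kernelDenom_div_le (hr0 : 0 ≤ r) (hr : r < 1) {z w : Fin n → ℂ}
    (hz : z ∈ unitPolydisc n) (hw : w ∈ smallPolydisc n r) :
    ‖kernelDenom n (fun _ => (r : ℂ)) w / kernelDenom n z w‖ ≤
      2 ^ (n * n + n) / (1 - r) ^ (n * n + n) := by
  have h1 : 0 < 1 - r := by linarith
  rw [norm_div]
  gcongr
  · refine norm_kernelDenom_le (fun _ => ?_) fun j => ((hw j).trans hr).le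
    rw [Complex.norm_real, Real.norm_of_nonneg hr0]
    exact hr.le
  · refine pow_le_norm_kernelDenom n h1.le fun j k => ?_
    have h2 := norm_sub_norm_le (1 : ℂ) (z j * starRingEnd ℂ (w k))
    rw [norm_one, norm_mul, RCLike.norm_conj] at h2
    have h3 : ‖z j‖ * ‖w k‖ ≤ 1 * r :=
      mul_le_mul (hz j).le (hw k).le (norm_nonneg _) zero_le_one
    linarith

theorem norm_peakImage_integrand_le (hr0 : 0 ≤ r) (hr : r < 1) {z w : Fin n → ℂ}
    (hz : z ∈ unitPolydisc n) (hw : w ∈ smallPolydisc n r) :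
    ‖((‖symJacobian n w‖ ^ 2 * peakWeight n r w : ℝ) : ℂ) *
      ((Real.pi : ℂ) ^ n)⁻¹ * (kernelDenom n (fun _ => (r : ℂ)) w / kernelDenom n z w)‖ ≤
    (2 ^ (n * n)) ^ 2 * (((1 - r) ^ (2 * n))⁻¹) ^ n * ‖((Real.pi : ℂ) ^ n)⁻¹‖ *
      (2 ^ (n * n + n) / (1 - r) ^ (n * n + n)) := by
  rw [norm_mul, norm_mul, Complex.norm_real,
    Real.norm_of_nonneg (mul_nonneg (by positivity) (peakWeight_nonneg w))]
  have h1 : 0 < 1 - r := by linarith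
  exact mul_le_mul (mul_le_mul_of_nonneg_right
    (norm_sq_mul_peakWeight_le hr0 hr (smallPolydisc_subset hr.le hw)) (norm_nonneg _))
    (norm_kernelDenom_div_le hr0 hr hz hw) (norm_nonneg _) (by positivity)

theorem integrableOn_peakImage_integrand (hr0 : 0 ≤ r) (hr : r < 1) {z : Fin n → ℂ}
    (hz : z ∈ unitPolydisc n) :
    IntegrableOn (fun w => ((‖symJacobian n w‖ ^ 2 * peakWeight n r w : ℝ) : ℂ) *
      ((Real.pi : ℂ) ^ n)⁻¹ * (kernelDenom n (fun _ => (r : ℂ)) w / kernelDenom n z w))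
      (smallPolydisc n r) := by
  refine IntegrableOn.of_bound (volume_smallPolydisc_lt_top hr.le) ?_ _
    ((ae_restrict_iff' (isOpen_smallPolydisc n r).measurableSet).2
    (Filter.Eventually.of_forall fun w hw => norm_peakImage_integrand_le hr0 hr hz hw))
  refine Measurable.aestronglyMeasurable (((Complex.measurable_ofReal.comp
    (measurable_norm_sq_mul_peakWeight n r)).mul_const _).mul (Measurable.div ?_ ?_))
  · exact ((continuous_kernelDenom n).comp (continuous_const.prodMk continuous_id)).measurable
  · exact ((continuous_kernelDenom n).comp (continuous_const.prodMk continuous_id)).measurable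

/-- Permuting the integration variable preserves Lebesgue measure and leaves every factor of the
integrand unchanged. -/
theorem peakImage_comp_perm (σ : Equiv.Perm (Fin n)) (hσ : ∀ w,
    ‖symJacobian n (w ∘ σ)‖ = ‖symJacobian n w‖) (z : Fin n → ℂ) :
    peakImage n r (z ∘ σ) = peakImage n r z := by
  have hmp := volume_measurePreserving_piCongrLeft (fun _ : Fin n => ℂ) σ.symm
  have hme : ∀ w, MeasurableEquiv.piCongrLeft (fun _ : Fin n => ℂ) σ.symm w = w ∘ σ := by
    intro w
    ext j
    have := MeasurableEquiv.piCongrLeft_apply_apply (β := fun _ => ℂ) σ.symm w (σ j)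
    rwa [Equiv.symm_apply_apply] at this
  have h := hmp.setIntegral_preimage_emb
    (MeasurableEquiv.measurableEmbedding _) (fun w =>
    ((‖symJacobian n w‖ ^ 2 * peakWeight n r w : ℝ) : ℂ) * ((Real.pi : ℂ) ^ n)⁻¹ *
      (kernelDenom n (fun _ => (r : ℂ)) w / kernelDenom n (z ∘ σ) w)) (smallPolydisc n r)
  rw [peakImage, ← h, peakImage]
  congr 1
  · congr 1
    ext w
    rw [Set.mem_preimage, hme, comp_perm_mem_smallPolydisc]
  · ext w
    rw [hme, hσ, peakWeight_comp_perm, kernelDenom_comp_perm]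
    congr 2
    exact kernelDenom_comp_perm n (fun _ => (r : ℂ)) w σ

theorem operatorT2_peakFunction_mem_LpAnti {p : ℝ} (hp : 0 < p) (hr0 : 0 ≤ r) (hr : r < 1) :
    operatorT2 n (peakFunction n r) ∈ LpAnti n p := by
  rw [funext fun z => operatorT2_peakFunction hr.le z]
  refine symJacobian_mul_mem_LpAnti n hp (measurable_peakImage n r) (fun z hz =>
    norm_setIntegral_le_of_norm_le_const (volume_smallPolydisc_lt_top hr.le)
      fun w hw => norm_peakImage_integrand_le hr0 hr hz hw) fun z _ j k => ?_
  refine peakImage_comp_perm _ (fun w => ?_) z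
  rcases eq_or_ne j k with rfl | h
  · simp
  · rw [symJacobian_comp_swap n w h, norm_neg]

/-! ### Lower bound for the image near the point `(r, …, r)`. -/

theorem one_fourth_le_re_inv {P : ℂ} (h : ‖P - 1‖ ≤ 1 / 4) : 1 / 4 ≤ (P⁻¹).re := by
  have h1 : 3 / 4 ≤ P.re := by
    have := (abs_le.1 ((Complex.abs_re_le_norm (P - 1)).trans h)).1
    simp at this
    linarith
  have h2 : ‖P‖ ≤ 5 / 4 := by
    calc ‖P‖ = ‖1 + (P - 1)‖ := by ring_nf
      _ ≤ 1 + 1 / 4 := (norm_add_le _ _).trans (by rw [norm_one]; linarith)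
      _ = 5 / 4 := by norm_num
  have h3 : Complex.normSq P ≤ 25 / 16 := by
    rw [Complex.normSq_eq_norm_sq]
    nlinarith [norm_nonneg P]
  have h4 : 0 < Complex.normSq P := by
    rw [Complex.normSq_pos]
    rintro rfl
    simp at h1
    linarith
  rw [Complex.inv_re, le_div_iff₀ h4]
  linarith

/-- Since `|1 - r w̄_k| ≥ 1 - r`, moving `z_j` by at most `ε (1 - r)` changes each factor by a
relative error at most `ε`. With `n² + n` factors the inverse quotient stays within `1/4` of `1`, so
there is no cancellation in the integral `peakImage`. -/
theorem one_fourth_le_re_kernelDenom_div (hr0 : 0 ≤ r) (hr : r < 1) {ε : ℝ} (hε0 : 0 ≤ ε)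
    (hε : (n * n + n) * ε ≤ 1 / 8) {z w : Fin n → ℂ}
    (hz : ∀ j, ‖z j - r‖ ≤ ε * (1 - r)) (hw : w ∈ smallPolydisc n r) :
    1 / 4 ≤ (kernelDenom n (fun _ => (r : ℂ)) w / kernelDenom n z w).re := by
  set t : (Fin n × Fin n) ⊕ Fin n → ℂ := fun x =>
    -((z (Sum.elim Prod.fst id x) - r) * starRingEnd ℂ (w (Sum.elim Prod.snd id x)) /
      (1 - r * starRingEnd ℂ (w (Sum.elim Prod.snd id x)))) with ht
  have hlow : ∀ j, 1 - r ≤ ‖1 - (r : ℂ) * starRingEnd ℂ (w j)‖ := fun j =>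
    one_sub_le_norm hr0 ((hw j).trans hr).le
  have hpos : 0 < 1 - r := by linarith
  have hne : ∀ j, 1 - (r : ℂ) * starRingEnd ℂ (w j) ≠ 0 := fun j => by
    rw [← norm_pos_iff]
    exact hpos.trans_le (hlow j)
  have h1 : kernelDenom n z w / kernelDenom n (fun _ => (r : ℂ)) w = ∏ x, (1 + t x) := by
    rw [kernelDenom_eq_prod_sum, kernelDenom_eq_prod_sum, ← Finset.prod_div_distrib]
    refine Finset.prod_congr rfl fun x _ => ?_
    have := hne (Sum.elim Prod.snd id x)
    simp only [ht]
    rw [div_eq_iff this, add_mul, neg_mul, div_mul_cancel₀ _ this]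
    ring
  have h2 : ∀ x, ‖t x‖ ≤ ε := by
    intro x
    simp only [ht]
    rw [norm_neg, norm_div, norm_mul, RCLike.norm_conj,
      div_le_iff₀ (hpos.trans_le (hlow _))]
    calc _ ≤ ε * (1 - r) * 1 := by
          gcongr
          · exact hz _
          · exact ((hw _).trans hr).le
      _ ≤ _ := by
          rw [mul_one]
          gcongr
          exact hlow _
  have h3 : ∑ x, ‖t x‖ ≤ 1 / 8 := by
    refine le_trans (Finset.sum_le_sum fun x _ => h2 x) ?_
    simpa using hε
  have h4 : ‖∏ x, (1 + t x) - 1‖ ≤ 1 / 4 := by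
    refine (Finset.norm_prod_one_add_sub_one_le _ _).trans ?_
    have h0 : 0 ≤ ∑ x, ‖t x‖ := Finset.sum_nonneg fun _ _ => norm_nonneg _
    -- `|e^x - 1| ≤ 2|x|` for `|x| ≤ 1` turns `1/8` into `1/4`.
    have := Real.abs_exp_sub_one_le (x := ∑ x, ‖t x‖) (by rw [abs_of_nonneg h0]; linarith)
    rw [abs_of_nonneg h0] at this
    linarith [le_abs_self (Real.exp (∑ x, ‖t x‖) - 1)]
  have h5 := one_fourth_le_re_inv h4
  rwa [← h1, inv_div] at h5

theorem le_norm_peakImage (hr0 : 0 ≤ r) (hr : r < 1) {ε : ℝ} (hε0 : 0 ≤ ε)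
    (hε : (n * n + n) * ε ≤ 1 / 8) {z : Fin n → ℂ}
    (hz : ∀ j, ‖z j - r‖ ≤ ε * (1 - r)) (hzD : z ∈ unitPolydisc n) :
    (4 * Real.pi ^ n)⁻¹ * peakMass n r ≤ ‖peakImage n r z‖ := by
  have hm := (isOpen_smallPolydisc n r).measurableSet
  have hint := integrableOn_peakImage_integrand hr0 hr hzD
  refine le_trans ?_ (Complex.re_le_norm _)
  have h1 : (peakImage n r z).re = ∫ w in smallPolydisc n r,
    (((‖symJacobian n w‖ ^ 2 * peakWeight n r w : ℝ) : ℂ) *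
      ((Real.pi : ℂ) ^ n)⁻¹ * (kernelDenom n (fun _ => (r : ℂ)) w / kernelDenom n z w)).re :=
    (integral_re hint).symm
  rw [h1, peakMass, ← integral_const_mul]
  refine setIntegral_mono_on ((integrableOn_norm_sq_mul_peakWeight hr0 hr).const_mul _)
    hint.re hm fun w hw => ?_
  have h2 := one_fourth_le_re_kernelDenom_div hr0 hr hε0 hε hz hw
  have h3 : ((‖symJacobian n w‖ ^ 2 * peakWeight n r w : ℝ) : ℂ) * ((Real.pi : ℂ) ^ n)⁻¹ =
      ((‖symJacobian n w‖ ^ 2 * peakWeight n r w * (Real.pi ^ n)⁻¹ : ℝ) : ℂ) := by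
    push_cast
    ring
  rw [h3, Complex.re_ofReal_mul, mul_inv]
  have h4 : 0 ≤ ‖symJacobian n w‖ ^ 2 * peakWeight n r w * (Real.pi ^ n)⁻¹ :=
    mul_nonneg (mul_nonneg (by positivity) (peakWeight_nonneg w)) (by positivity)
  nlinarith

/-! ### Lower bounds for the Jacobian on boxes with separated coordinates. -/

/-- Squaring counts each unordered pair twice, which gives a product over the `(n-1)n` ordered
off-diagonal pairs. -/
theorem pow_le_norm_symJacobian_sq {w : Fin n → ℂ} {t : ℝ} (ht : 0 ≤ t)
    (h : ∀ j k, j ≠ k → t ≤ ‖w j - w k‖) :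
    t ^ ((n - 1) * n) ≤ ‖symJacobian n w‖ ^ 2 := by
  have h1 : ‖symJacobian n w‖ ^ 2 = ∏ j, ∏ k ∈ {j}ᶜ, ‖w j - w k‖ := by
    rw [← Finset.prod_prod_Ioi_mul_eq_prod_prod_off_diag]
    simp only [Finset.prod_mul_distrib, symJacobian_eq, norm_prod, sq]
    simp only [norm_sub_rev]
  have h2 : ∀ j ∈ (univ : Finset (Fin n)), t ^ (n - 1) ≤ ∏ k ∈ {j}ᶜ, ‖w j - w k‖ := by
    intro j _
    calc t ^ (n - 1) = ∏ k ∈ ({j}ᶜ : Finset (Fin n)), t := by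
          rw [Finset.prod_const, card_compl, Fintype.card_fin, card_singleton]
      _ ≤ _ := Finset.prod_le_prod (fun _ _ => ht) fun k hk => h j k (by
          rintro rfl
          simp at hk)
  rw [h1]
  calc t ^ ((n - 1) * n) = ∏ j : Fin n, t ^ (n - 1) := by simp [pow_mul]
    _ ≤ _ := Finset.prod_le_prod (fun _ _ => pow_nonneg ht _) h2

theorem le_norm_symJacobian_succ_sq {m : ℕ} {w : Fin (m + 1) → ℂ} {s t : ℝ} (hs : 0 ≤ s)
    (ht : 0 ≤ t) (h0 : ∀ k : Fin m, s ≤ ‖w 0 - w k.succ‖)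
    (h : ∀ j k : Fin m, j ≠ k → t ≤ ‖w j.succ - w k.succ‖) :
    s ^ (2 * m) * t ^ ((m - 1) * m) ≤ ‖symJacobian (m + 1) w‖ ^ 2 := by
  have h1 : symJacobian (m + 1) w =
      (∏ k : Fin m, (w 0 - w k.succ)) * symJacobian m (fun j => w j.succ) := by
    rw [symJacobian_eq, symJacobian_eq, Fin.prod_univ_succ, Fin.prod_Ioi_zero]
    simp only [Fin.prod_Ioi_succ]
  have h2 := pow_le_norm_symJacobian_sq (w := fun j => w j.succ) ht h
  have h3 : s ^ m ≤ ‖∏ k : Fin m, (w 0 - w k.succ)‖ := by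
    rw [norm_prod]
    calc s ^ m = ∏ k : Fin m, s := by simp
      _ ≤ _ := Finset.prod_le_prod (fun _ _ => hs) fun k _ => h0 k
  rw [h1, norm_mul, mul_pow, mul_comm 2 m, pow_mul]
  gcongr

/-- A polydisc with separated centres near the point `(r, …, r)`. -/
def separatedBox (n : ℕ) (r d : ℝ) : Set (Fin n → ℂ) :=
  Set.univ.pi fun j => Metric.ball ((r + j * d : ℝ) : ℂ) (d / 4)

theorem norm_sub_le_of_mem_separatedBox {d : ℝ} {z : Fin n → ℂ}
    (hz : z ∈ separatedBox n r d) (j : Fin n) : ‖z j - r‖ ≤ n * d := by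
  have h1 := hz j trivial
  rw [mem_ball_iff_norm] at h1
  have hd : 0 ≤ d := by linarith [norm_nonneg (z j - ((r + j * d : ℝ) : ℂ))]
  have h2 : z j - r = (z j - ((r + j * d : ℝ) : ℂ)) + ((j * d : ℝ) : ℂ) := by
    push_cast
    ring
  have h3 : ((j : ℕ) : ℝ) + 1 ≤ n := by exact_mod_cast j.2
  rw [h2]
  refine (norm_add_le _ _).trans ?_
  rw [Complex.norm_real, Real.norm_of_nonneg (mul_nonneg (Nat.cast_nonneg _) hd)]
  nlinarith

theorem le_norm_sub_of_mem_ball {d : ℝ} {x y : ℝ} (hxy : d ≤ |x - y|) {a b : ℂ}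
    (ha : a ∈ Metric.ball (x : ℂ) (d / 4)) (hb : b ∈ Metric.ball (y : ℂ) (d / 4)) :
    d / 2 ≤ ‖a - b‖ := by
  rw [mem_ball_iff_norm] at ha hb
  have h1 : ((x - y : ℝ) : ℂ) = (a - b) + ((b - y) - (a - x)) := by
    push_cast
    ring
  have h2 : |x - y| = ‖((x - y : ℝ) : ℂ)‖ := by rw [Complex.norm_real, Real.norm_eq_abs]
  rw [h2, h1] at hxy
  have h3 := norm_add_le (a - b) ((b - y) - (a - x))
  have h4 := norm_sub_le (b - y) (a - x)
  linarith

theorem le_abs_natCast_mul_sub {d : ℝ} (hd : 0 ≤ d) {j k : ℕ} (h : j ≠ k) :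
    d ≤ |(j : ℝ) * d - k * d| := by
  rw [← sub_mul, abs_mul, abs_of_nonneg hd]
  have : (1 : ℝ) ≤ |(j : ℝ) - k| := by
    have : (1 : ℤ) ≤ |(j : ℤ) - k| := Int.one_le_abs (by omega)
    exact_mod_cast this
  nlinarith

theorem volume_ball_ofReal {x : ℂ} {d : ℝ} (hd : 0 ≤ d) :
    volume (Metric.ball x d) = ENNReal.ofReal (Real.pi * d ^ 2) := by
  rw [Complex.volume_ball, mul_comm, ENNReal.ofReal_mul Real.pi_pos.le, ENNReal.ofReal_pow hd,
    ← NNReal.coe_real_pi, ENNReal.ofReal_coe_nnreal]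

theorem le_lintegral_separatedBox {d : ℝ} (hd : 0 ≤ d) :
    ENNReal.ofReal ((d / 2) ^ ((n - 1) * n) * (Real.pi * (d / 4) ^ 2) ^ n) ≤
      ∫⁻ w in separatedBox n r d, ‖symJacobian n w‖ₑ ^ (2 : ℝ) := by
  have hvol : volume (separatedBox n r d) = ENNReal.ofReal ((Real.pi * (d / 4) ^ 2) ^ n) := by
    rw [separatedBox, volume_pi_pi]
    simp only [volume_ball_ofReal (by linarith : 0 ≤ d / 4)]
    rw [Finset.prod_const, card_univ, Fintype.card_fin, ENNReal.ofReal_pow (by positivity)]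
  rw [ENNReal.ofReal_mul (by positivity), ← hvol, ← setLIntegral_const]
  refine setLIntegral_mono' (MeasurableSet.univ_pi fun _ => measurableSet_ball) fun w hw => ?_
  rw [← ofReal_norm, ENNReal.ofReal_rpow_of_nonneg (norm_nonneg _) zero_le_two, Real.rpow_two]
  refine ENNReal.ofReal_le_ofReal (pow_le_norm_symJacobian_sq (by positivity) fun j k hjk => ?_)
  refine le_norm_sub_of_mem_ball ?_ (hw j trivial) (hw k trivial)
  rw [add_sub_add_left_eq_sub]
  exact le_abs_natCast_mul_sub hd (Fin.val_ne_of_ne hjk)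

/-! ### Logarithmic divergence of the mass. -/

/-- A polydisc whose first coordinate lies at distance about `s` from `1`, and the others at
distance about `d`. -/
def escapingBox (m : ℕ) (d s : ℝ) : Set (Fin (m + 1) → ℂ) :=
  Set.univ.pi (Fin.cons (α := fun _ => Set ℂ) (Metric.ball ((1 - s : ℝ) : ℂ) (s / 4))
    fun k : Fin m => Metric.ball ((1 - 2 * d - k * d : ℝ) : ℂ) (d / 4))

variable {m : ℕ} {d s : ℝ} {w : Fin (m + 1) → ℂ}

theorem mem_escapingBox : w ∈ escapingBox m d s ↔ w 0 ∈ Metric.ball ((1 - s : ℝ) : ℂ) (s / 4) ∧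
    ∀ k : Fin m, w k.succ ∈ Metric.ball ((1 - 2 * d - k * d : ℝ) : ℂ) (d / 4) := by
  simp [escapingBox, Set.mem_pi, Fin.forall_fin_succ]

theorem measurableSet_escapingBox : MeasurableSet (escapingBox m d s) := by
  refine MeasurableSet.univ_pi fun j => ?_
  refine Fin.cases ?_ (fun k => ?_) j
  · exact measurableSet_ball
  · exact measurableSet_ball

theorem volume_escapingBox (hd : 0 ≤ d) (hs : 0 ≤ s) : volume.real (escapingBox m d s) =
    Real.pi * (s / 4) ^ 2 * (Real.pi * (d / 4) ^ 2) ^ m := by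
  rw [measureReal_def, escapingBox, volume_pi_pi, Fin.prod_univ_succ]
  simp only [Fin.cons_zero, Fin.cons_succ]
  simp only [volume_ball_ofReal (by linarith : 0 ≤ d / 4),
    volume_ball_ofReal (by linarith : 0 ≤ s / 4), Finset.prod_const, card_univ, Fintype.card_fin]
  rw [← ENNReal.ofReal_pow (by positivity), ← ENNReal.ofReal_mul (by positivity),
    ENNReal.toReal_ofReal (by positivity)]

theorem norm_one_sub_bounds {x : ℝ} {a : ℂ} {ρ : ℝ} (hx : 0 ≤ x)
    (ha : a ∈ Metric.ball ((1 - x : ℝ) : ℂ) ρ) : x - ρ < ‖1 - a‖ ∧ ‖1 - a‖ < x + ρ := by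
  rw [mem_ball_iff_norm'] at ha
  have h1 : (1 : ℂ) - a = (x : ℂ) + (((1 - x : ℝ) : ℂ) - a) := by
    push_cast
    ring
  have h2 : ‖(x : ℂ)‖ = x := by rw [Complex.norm_real, Real.norm_of_nonneg hx]
  rw [h1]
  have h3 := norm_add_le (x : ℂ) (((1 - x : ℝ) : ℂ) - a)
  have h4 := norm_sub_le_norm_add (x : ℂ) (((1 - x : ℝ) : ℂ) - a)
  constructor <;> linarith

theorem norm_lt_of_mem_ball_one_sub {x : ℝ} {a : ℂ} {ρ : ℝ} (hx : x ≤ 1)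
    (ha : a ∈ Metric.ball ((1 - x : ℝ) : ℂ) ρ) : ‖a‖ < 1 - x + ρ := by
  rw [mem_ball_iff_norm] at ha
  have h1 := norm_add_le ((1 - x : ℝ) : ℂ) (a - ((1 - x : ℝ) : ℂ))
  rw [Complex.norm_real, Real.norm_of_nonneg (by linarith), add_sub_cancel] at h1
  linarith

theorem norm_one_sub_mul_conj_le {δ : ℝ} (hδ : 0 ≤ δ) {a : ℂ} (ha : ‖a‖ ≤ 1) :
    ‖1 - ((1 - δ : ℝ) : ℂ) * starRingEnd ℂ a‖ ≤ ‖1 - a‖ + δ := by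
  have h1 : 1 - ((1 - δ : ℝ) : ℂ) * starRingEnd ℂ a =
      starRingEnd ℂ (1 - a) + (δ : ℂ) * starRingEnd ℂ a := by
    rw [map_sub, map_one]
    push_cast
    ring
  rw [h1]
  refine (norm_add_le _ _).trans ?_
  rw [norm_mul, RCLike.norm_conj, RCLike.norm_conj, Complex.norm_real, Real.norm_of_nonneg hδ]
  nlinarith

theorem mem_ball_escapingBox (hw : w ∈ escapingBox m d s) (k : Fin m) :
    w k.succ ∈ Metric.ball ((1 - (k + 2) * d : ℝ) : ℂ) (d / 4) := by
  have := (mem_escapingBox.1 hw).2 k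
  rwa [show (1 - 2 * d - k * d : ℝ) = 1 - (k + 2) * d by ring] at this

/-- The centres `1 - (k+2)d` start at `1 - 2d`, so balls of radius `d/4` around them stay below the
truncation radius `1 - d`. -/
theorem escapingBox_subset (hd : 0 < d) (hs : 4 * (m + 5) * d ≤ s) (hs1 : s ≤ 1) :
    escapingBox m d s ⊆ smallPolydisc (m + 1) (1 - d) := by
  intro w hw j
  have hm : (0 : ℝ) ≤ m := Nat.cast_nonneg m
  refine Fin.cases ?_ (fun k => ?_) j
  · have := norm_lt_of_mem_ball_one_sub hs1 (mem_escapingBox.1 hw).1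
    nlinarith
  · have hk : ((k : ℕ) : ℝ) + 1 ≤ m := by exact_mod_cast k.2
    have hk0 : (0 : ℝ) ≤ ((k : ℕ) : ℝ) := Nat.cast_nonneg _
    have := norm_lt_of_mem_ball_one_sub (by nlinarith) (mem_ball_escapingBox hw k)
    nlinarith

theorem le_integrand_escapingBox (hd : 0 < d) (hs : 4 * (m + 5) * d ≤ s) (hs1 : s ≤ 1)
    (hw : w ∈ escapingBox m d s) :
    (s / 2) ^ (2 * m) * (d / 2) ^ ((m - 1) * m) * (((2 * s) ^ (2 * (m + 1)))⁻¹ *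
      ((((m + 5) * d) ^ (2 * (m + 1)))⁻¹) ^ m) ≤
      ‖symJacobian (m + 1) w‖ ^ 2 * peakWeight (m + 1) (1 - d) w := by
  have hm : (0 : ℝ) ≤ m := Nat.cast_nonneg m
  have hs0 : 0 < s := by nlinarith
  have hd1 : d ≤ 1 := by nlinarith
  have hsd : d ≤ s / 4 := by nlinarith
  have hwS := escapingBox_subset hd hs hs1 hw
  have h0 := norm_one_sub_bounds hs0.le (mem_escapingBox.1 hw).1
  have hk : ∀ k : Fin m, ‖1 - w k.succ‖ ≤ (m + 2) * d := by
    intro k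
    have hk : ((k : ℕ) : ℝ) + 1 ≤ m := by exact_mod_cast k.2
    have := (norm_one_sub_bounds (by positivity) (mem_ball_escapingBox hw k)).2
    nlinarith
  have hpos : ∀ j, 0 < ‖1 - ((1 - d : ℝ) : ℂ) * starRingEnd ℂ (w j)‖ := fun j => by
    have := one_sub_le_norm (r := 1 - d) (by linarith) ((hwS j).le.trans (by linarith))
    linarith
  have hle : ∀ j, ‖1 - ((1 - d : ℝ) : ℂ) * starRingEnd ℂ (w j)‖ ≤ ‖1 - w j‖ + d := fun j =>
    norm_one_sub_mul_conj_le hd.le ((hwS j).le.trans (by linarith))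
  have hJ : (s / 2) ^ (2 * m) * (d / 2) ^ ((m - 1) * m) ≤ ‖symJacobian (m + 1) w‖ ^ 2 := by
    refine le_norm_symJacobian_succ_sq (by positivity) (by positivity) (fun k => ?_)
      fun j k hjk => ?_
    -- Coordinate `0` is at distance at least `3s/4` from `1`, the others at most `(m+2)d ≤ s/4`.
    · have h1 := norm_sub_norm_le (1 - w 0) (1 - w k.succ)
      rw [sub_sub_sub_cancel_left, norm_sub_rev (w k.succ)] at h1
      have h2 := hk k
      nlinarith
    · refine le_norm_sub_of_mem_ball ?_ ((mem_escapingBox.1 hw).2 j)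
        ((mem_escapingBox.1 hw).2 k)
      rw [sub_sub_sub_cancel_left]
      exact le_abs_natCast_mul_sub hd.le (Fin.val_ne_of_ne hjk.symm)
  have hQ : ((2 * s) ^ (2 * (m + 1)))⁻¹ * ((((m + 5) * d) ^ (2 * (m + 1)))⁻¹) ^ m ≤
      peakWeight (m + 1) (1 - d) w := by
    rw [peakWeight, Fin.prod_univ_succ]
    have h1 : ((((m + 5) * d) ^ (2 * (m + 1)))⁻¹) ^ m =
        ∏ k : Fin m, (((m + 5) * d) ^ (2 * (m + 1)))⁻¹ := by simp
    rw [h1]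
    refine mul_le_mul ?_ (Finset.prod_le_prod (fun _ _ => by positivity) fun k _ => ?_)
      (by positivity) (by positivity)
    · have := hle 0
      have := hpos 0
      refine inv_anti₀ (by positivity) (pow_le_pow_left₀ (by positivity) ?_ _)
      linarith
    · have := hle k.succ
      have := hpos k.succ
      have := hk k
      refine inv_anti₀ (by positivity) (pow_le_pow_left₀ (by positivity) ?_ _)
      linarith
  exact mul_le_mul hJ hQ (by positivity) (by positivity)

/-- The lower bound for the normalized mass of a single box. -/
noncomputable def boxConstant (m : ℕ) : ℝ :=
  (1 / 2) ^ (2 * m) * (1 / 2) ^ ((m - 1) * m) * ((2 ^ (2 * (m + 1)))⁻¹ *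
      ((((m + 5 : ℝ)) ^ (2 * (m + 1)))⁻¹) ^ m) *
    (Real.pi * (1 / 4) ^ 2 * (Real.pi * (1 / 4) ^ 2) ^ m)

theorem boxConstant_pos (m : ℕ) : 0 < boxConstant m := by
  unfold boxConstant
  positivity

/-- All powers of `s` cancel: `s^(2m)` from the Jacobian, `s^(-2(m+1))` from the weight and `s²`
from the volume. This scale invariance is the source of the logarithm. -/
theorem boxConstant_eq (hd : 0 < d) (hs : 0 < s) :
    (s / 2) ^ (2 * m) * (d / 2) ^ ((m - 1) * m) * (((2 * s) ^ (2 * (m + 1)))⁻¹ *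
      ((((m + 5) * d) ^ (2 * (m + 1)))⁻¹) ^ m) *
      (Real.pi * (s / 4) ^ 2 * (Real.pi * (d / 4) ^ 2) ^ m) =
    boxConstant m * (d ^ (m * (m + 1)))⁻¹ := by
  have h1 : d ^ ((m - 1) * m) * d ^ (2 * m) = d ^ (m * (m + 1)) := by
    rw [← pow_add]
    congr 1
    -- Natural subtraction truncates `m - 1` at `m = 0`, where both exponents are `0`.
    cases m
    · simp
    · simp
      ring
  have h2 : (d ^ (2 * (m + 1))) ^ m = d ^ (m * (m + 1)) * d ^ (m * (m + 1)) := by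
    rw [← pow_add, ← pow_mul]
    congr 1
    ring
  have h3 : s ^ (2 * (m + 1)) = s ^ (2 * m) * s ^ 2 := by ring
  have h4 : d ^ ((m - 1) * m) * (d ^ 2) ^ m * ((d ^ (2 * (m + 1))) ^ m)⁻¹ =
      (d ^ (m * (m + 1)))⁻¹ := by
    rw [← pow_mul, h1, h2]
    field_simp
  have h5 : s ^ (2 * m) * s ^ 2 * (s ^ (2 * (m + 1)))⁻¹ = 1 := by
    rw [h3]
    field_simp
  rw [boxConstant, ← h4]
  simp only [div_eq_mul_inv, mul_pow, mul_inv, inv_pow, one_mul]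
  linear_combination (d ^ ((m - 1) * m) * (d ^ 2) ^ m * ((d ^ (2 * (m + 1))) ^ m)⁻¹) *
    ((2 ^ (2 * m))⁻¹ * (2 ^ ((m - 1) * m))⁻¹ * ((2 ^ (2 * (m + 1)))⁻¹ *
      ((((m + 5 : ℝ)) ^ (2 * (m + 1))) ^ m)⁻¹) *
      (Real.pi * (4 ^ 2)⁻¹ * (Real.pi ^ m * ((4 ^ 2) ^ m)⁻¹)))
      * h5

/-- The `M` scales `s = A^(i+1) d`, `i < M`, give disjoint boxes inside the truncated polydisc, each
with the same lower bound for its mass. -/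
theorem le_peakMass (m M : ℕ) (hd : 0 < d) (hM : (4 * (m + 5) : ℝ) ^ M * d ≤ 1)
    (hd1 : 4 * (m + 5) * d ≤ 1) :
    M * boxConstant m ≤ peakMass (m + 1) (1 - d) * d ^ (m * (m + 1)) := by
  have hm : (0 : ℝ) ≤ m := Nat.cast_nonneg m
  set A : ℝ := 4 * (m + 5) with hA
  have hA1 : 20 ≤ A := by linarith
  have hd' : d ≤ 1 := by nlinarith
  have hlow : ∀ i : ℕ, 4 * (m + 5) * d ≤ A ^ (i + 1) * d := fun i => by
    gcongr
    exact le_self_pow₀ (by linarith) (by omega)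
  have hup : ∀ i ∈ range M, A ^ (i + 1) * d ≤ 1 := fun i hi => by
    refine le_trans ?_ hM
    gcongr
    · linarith
    · exact mem_range.1 hi
  have hdisj : ∀ i j : ℕ, i < j →
      Disjoint (escapingBox m d (A ^ (i + 1) * d)) (escapingBox m d (A ^ (j + 1) * d)) := by
    intro i j hij
    rw [Set.disjoint_left]
    intro w hi hj
    have hi := (norm_one_sub_bounds (by positivity) (mem_escapingBox.1 hi).1).2
    have hj := (norm_one_sub_bounds (by positivity) (mem_escapingBox.1 hj).1).1
    have h1 : A * (A ^ (i + 1) * d) ≤ A ^ (j + 1) * d := by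
      rw [← mul_assoc, ← pow_succ']
      gcongr
      · linarith
      · omega
    have h2 : 0 < A ^ (i + 1) * d := by positivity
    -- The smaller scale forces `|1 - w 0| < 5s/4`, the larger one `|1 - w 0| > 3As/4`, which is
    -- incompatible with `A ≥ 20`.
    nlinarith
  have hint := integrableOn_norm_sq_mul_peakWeight (n := m + 1) (r := 1 - d) (by linarith)
    (by linarith)
  have hsub : (⋃ i ∈ range M, escapingBox m d (A ^ (i + 1) * d)) ⊆
      smallPolydisc (m + 1) (1 - d) :=
    Set.iUnion₂_subset fun i hi => escapingBox_subset hd (hlow i) (hup i hi)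
  have h1 := setIntegral_mono_set hint (Filter.Eventually.of_forall fun w =>
    mul_nonneg (by positivity) (peakWeight_nonneg w)) hsub.eventuallyLE
  rw [integral_biUnion_finset _ (fun _ _ => measurableSet_escapingBox)
    (fun i _ j _ hij => ?_) (fun i hi => hint.mono_set
      (escapingBox_subset hd (hlow i) (hup i hi)))] at h1
  · have hdp : 0 < d ^ (m * (m + 1)) := by positivity
    rw [← mul_inv_le_iff₀ hdp, mul_assoc]
    refine le_trans ?_ h1
    calc (M : ℝ) * (boxConstant m * (d ^ (m * (m + 1)))⁻¹) =
        ∑ i ∈ range M, boxConstant m * (d ^ (m * (m + 1)))⁻¹ := by simp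
      _ ≤ _ := Finset.sum_le_sum fun i hi => ?_
    have hs : 0 < A ^ (i + 1) * d := by positivity
    rw [← boxConstant_eq hd hs, ← volume_escapingBox hd.le hs.le, mul_comm]
    have hfin : volume (escapingBox m d (A ^ (i + 1) * d)) ≠ ∞ :=
      ((measure_mono (escapingBox_subset hd (hlow i) (hup i hi))).trans_lt
        (volume_smallPolydisc_lt_top (by linarith))).ne
    rw [mul_comm]
    exact setIntegral_ge_of_const_le_real measurableSet_escapingBox hfin
      (fun w hw => le_integrand_escapingBox hd (hlow i) (hup i hi) hw)
      (hint.mono_set (escapingBox_subset hd (hlow i) (hup i hi)))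
  · rcases lt_or_gt_of_ne hij with h | h
    · exact hdisj i j h
    · exact (hdisj j i h).symm

end

/-! ### Comparison of the two norms and conclusion. -/

/-- The integral is restricted to a separated box of spacing `η(1 - r)`. Its points are within `nη(1
- r)` of `r` in each coordinate, so `ε = nη` in `le_norm_peakImage`. -/
theorem le_weightedLpNorm_operatorT2_peakFunction {n : ℕ} {r : ℝ} {p : ℝ} (hp : 0 < p)
    (hr0 : 0 ≤ r) (hr : r < 1) {η : ℝ} (hη : 0 ≤ η) (hη1 : n * η < 1)
    (hε : (n * n + n) * (n * η) ≤ 1 / 8) :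
    (ENNReal.ofReal ((η * (1 - r) / 2) ^ ((n - 1) * n) * (Real.pi * (η * (1 - r) / 4) ^ 2) ^ n *
      ((4 * Real.pi ^ n)⁻¹ * peakMass n r) ^ p)) ^ (1 / p) ≤
      weightedLpNorm n p (operatorT2 n (peakFunction n r)) := by
  have hr' : 0 < 1 - r := by linarith
  have hclose : ∀ z ∈ separatedBox n r (η * (1 - r)), ∀ j, ‖z j - r‖ ≤ n * η * (1 - r) :=
    fun z hz j => (norm_sub_le_of_mem_separatedBox hz j).trans_eq (mul_assoc _ _ _).symm
  have hsub : separatedBox n r (η * (1 - r)) ⊆ unitPolydisc n := by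
    intro z hz j
    have h1 := hclose z hz j
    have h2 := norm_add_le (r : ℂ) (z j - r)
    rw [add_sub_cancel, Complex.norm_real, Real.norm_of_nonneg hr0] at h2
    nlinarith
  rw [funext fun z => operatorT2_peakFunction hr.le z,
    weightedLpNorm_symJacobian_mul n hp (measurable_peakImage n r)]
  refine ENNReal.rpow_le_rpow (le_trans ?_ (lintegral_mono_set hsub)) (by positivity)
  have hκ : 0 ≤ (4 * Real.pi ^ n)⁻¹ * peakMass n r := mul_nonneg (by positivity) peakMass_nonneg
  rw [ENNReal.ofReal_mul (by positivity), ← ENNReal.ofReal_rpow_of_nonneg hκ hp.le]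
  refine (mul_le_mul_left (le_lintegral_separatedBox (r := r) (by positivity)) _).trans ?_
  rw [← lintegral_mul_const' _ _ (ENNReal.rpow_ne_top_of_nonneg hp.le ENNReal.ofReal_ne_top)]
  refine setLIntegral_mono' (MeasurableSet.univ_pi fun _ => measurableSet_ball) fun z hz => ?_
  gcongr
  rw [← ofReal_norm]
  exact ENNReal.ofReal_le_ofReal
    (le_norm_peakImage hr0 hr (by positivity) hε (hclose z hz) (hsub hz))

theorem theorem4p4 (n : ℕ) (hn : 2 ≤ n) (p : ℝ) (hp : p = 2 * (n : ℝ) / ((n : ℝ) - 1)) :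
    (∀ f ∈ LpAnti n p, ∀ z ∈ unitPolydisc n,
      IntegrableOn (fun w => kernelT2 n z w * f w) (unitPolydisc n)) ∧
    ∀ C : ℝ≥0, ∃ f ∈ LpAnti n p, operatorT2 n f ∈ LpAnti n p ∧
      (C : ℝ≥0∞) * weightedLpNorm n p f < weightedLpNorm n p (operatorT2 n f) := by
  obtain ⟨m, rfl⟩ : ∃ m, n = m + 1 := ⟨n - 1, by omega⟩
  have hm : (1 : ℝ) ≤ m := by exact_mod_cast (by omega : 1 ≤ m)
  have hp1 : p - 1 = (m + 2) / m := by
    rw [hp]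
    push_cast
    have : (m : ℝ) ≠ 0 := by linarith
    rw [add_sub_cancel_right]
    field_simp
    ring
  have hp2 : 2 ≤ p := by
    have : 1 ≤ p - 1 := by
      rw [hp1, le_div_iff₀ (by linarith)]
      linarith
    linarith
  have hp0 : 0 < p := by linarith
  refine ⟨fun f hf z hz => integrableOn_kernelT2_mul _ hp2 hf hz, fun C => ?_⟩
  set N : ℝ := ((m + 1 : ℕ) : ℝ) with hN
  have hN1 : 2 ≤ N := by
    rw [hN]
    exact_mod_cast hn
  -- Chosen so that `ε = Nη` satisfies `(N² + N) ε = 1/8` exactly.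
  set η : ℝ := 1 / (8 * (N * N + N) * N) with hη
  have hη0 : 0 < η := by positivity
  have hη2 : (N * N + N) * (N * η) ≤ 1 / 8 := by
    rw [hη]
    apply le_of_eq
    field_simp
  have hη1 : N * η < 1 := by
    have : 0 < N * η := by positivity
    nlinarith
  set κ : ℝ := (4 * Real.pi ^ (m + 1))⁻¹ with hκ
  have hκ0 : 0 < κ := by positivity
  set b : ℝ := (η / 2) ^ (m * (m + 1)) * (Real.pi * (η / 4) ^ 2) ^ (m + 1) with hb
  have hb0 : 0 < b := by positivity
  have ha := boxConstant_pos m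
  -- The number of scales alone makes the norm ratio exceed `C`: the remaining constants `κ`, `b`,
  -- `boxConstant m` do not depend on `d`.
  obtain ⟨M, hM1, hM⟩ : ∃ M : ℕ, 1 ≤ M ∧
      (C : ℝ) ^ p / (κ ^ p * b) < (M * boxConstant m) ^ (p - 1) := by
    have h1 : Filter.Tendsto (fun M : ℕ => ((M : ℝ) * boxConstant m) ^ (p - 1))
        Filter.atTop Filter.atTop :=
      (tendsto_rpow_atTop (by linarith)).comp
        (tendsto_natCast_atTop_atTop.atTop_mul_const ha)
    obtain ⟨M, h2, h3⟩ := ((Filter.eventually_ge_atTop 1).and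
      (h1.eventually_gt_atTop ((C : ℝ) ^ p / (κ ^ p * b)))).exists
    exact ⟨M, h2, h3⟩
  -- With this `d` the largest of the `M` scales is exactly `1`.
  set d : ℝ := ((4 * (m + 5) : ℝ) ^ M)⁻¹ with hd
  have hd0 : 0 < d := by positivity
  have hdM : (4 * (m + 5) : ℝ) ^ M * d ≤ 1 := (mul_inv_cancel₀ (by positivity)).le
  have hd1 : 4 * (m + 5) * d ≤ 1 := by
    refine le_trans ?_ hdM
    gcongr
    exact le_self_pow₀ (by linarith) (by omega)
  have hd2 : d ≤ 1 := by nlinarith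
  have hmass := le_peakMass m M hd0 hdM hd1
  set P := peakMass (m + 1) (1 - d) with hP
  have hP0 : 0 < P := by
    have hM0 : (0 : ℝ) < M := by exact_mod_cast hM1
    exact pos_of_mul_pos_left (lt_of_lt_of_le (by positivity) hmass) (by positivity)
  have hr0 : 0 ≤ 1 - d := by linarith
  have hr1 : 1 - d < 1 := by linarith
  refine ⟨peakFunction (m + 1) (1 - d), peakFunction_mem_LpAnti hp0 hr0 hr1,
    operatorT2_peakFunction_mem_LpAnti hp0 hr0 hr1, ?_⟩
  refine lt_of_lt_of_le ?_
    (le_weightedLpNorm_operatorT2_peakFunction hp0 hr0 hr1 hη0.le hη1 hη2)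
  rw [weightedLpNorm_peakFunction hn hr0 hr1 hp hp0, sub_sub_cancel, add_tsub_cancel_right, ← hP,
    ← hκ]
  have hC : (C : ℝ≥0∞) = ENNReal.ofReal ((C : ℝ) ^ p) ^ (1 / p) := by
    rw [← ENNReal.ofReal_rpow_of_nonneg (NNReal.coe_nonneg C) hp0.le, ← ENNReal.rpow_mul,
      mul_one_div_cancel hp0.ne', ENNReal.rpow_one, ENNReal.ofReal_coe_nnreal]
  rw [hC, ← ENNReal.mul_rpow_of_nonneg _ _ (by positivity), ← ENNReal.ofReal_mul (by positivity)]
  refine ENNReal.rpow_lt_rpow ((ENNReal.ofReal_lt_ofReal_iff (by positivity)).2 ?_) (by positivity)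
  have h1 : (η * d / 2) ^ (m * (m + 1)) * (Real.pi * (η * d / 4) ^ 2) ^ (m + 1) =
      b * d ^ ((m + 1) * (m + 2)) := by
    rw [hb]
    have e1 : (η * d / 2) ^ (m * (m + 1)) = (η / 2) ^ (m * (m + 1)) * d ^ (m * (m + 1)) := by
      rw [← mul_pow]
      ring
    have e2 : (Real.pi * (η * d / 4) ^ 2) ^ (m + 1) =
        (Real.pi * (η / 4) ^ 2) ^ (m + 1) * d ^ (2 * (m + 1)) := by
      rw [pow_mul, ← mul_pow]
      ring
    have e3 : d ^ ((m + 1) * (m + 2)) = d ^ (m * (m + 1)) * d ^ (2 * (m + 1)) := by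
      rw [← pow_add]
      ring
    rw [e1, e2, e3]
    ring
  -- The critical exponent enters here: `m(m+1)(p-1) = (m+1)(m+2)`, so the power of `d` lost on the
  -- small box is exactly the normalization of the mass.
  have h2 : (P * d ^ (m * (m + 1))) ^ (p - 1) = P ^ (p - 1) * d ^ ((m + 1) * (m + 2)) := by
    rw [Real.mul_rpow hP0.le (by positivity)]
    congr 1
    rw [← Real.rpow_natCast, ← Real.rpow_natCast, ← Real.rpow_mul hd0.le, hp1]
    congr 1
    push_cast
    field_simp
  have h3 : P ^ p = P ^ (p - 1) * P := by
    rw [Real.rpow_sub_one hP0.ne', div_mul_cancel₀ _ hP0.ne']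
  have h4 : (C : ℝ) ^ p < κ ^ p * b * (P * d ^ (m * (m + 1))) ^ (p - 1) := by
    rw [div_lt_iff₀' (by positivity)] at hM
    refine hM.trans_le ?_
    gcongr
    linarith
  rw [h1, Real.mul_rpow hκ0.le hP0.le, h3]
  calc (C : ℝ) ^ p * P < κ ^ p * b * (P * d ^ (m * (m + 1))) ^ (p - 1) * P := by gcongr
    _ = _ := by
      rw [h2]
      ring
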